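/- Let $L\ge 3$ be an integer and let $\phi:\mathbb R\to\mathbb R$ be continuous with $\phi(t)=0$ for all $t\notin[0,L]$. Let $$\mathcal S(\phi)=\Big\{\sum_{k\in\mathbb Z}c_k\,\phi(\cdot-k):\ c_k\in\mathbb C\Big\}.$$ Assume that (a) $\phi$ is locally linearly independent on every interval $I_j=(j,j+1)$, $j\in\mathbb Z$, i.e. if $\sum_{k}c_k\phi(x-k)=0$ for all $x\in I_j$, then $c_k=0$ for every $k$ for which $\phi(\cdot-k)$ is not identically zero on $I_j$; (b) with $\Phi(x)=(\phi(x),\phi(x+1),\dots,\phi(x+L-1))^T$, the matrices $\Phi(x)\Phi(x)^T$, $x\in(0,1)$, span the space of all real symmetric $L\times L$ matrices. Then: 1. For every $j\in\mathbb Z$ the space $\mathcal S(\phi)$ is locally conjugate phase retrievable on $I_j$: if $f,g\in\mathcal S(\phi)$ and $|f(x)|=|g(x)|$ for all $x\in I_j$, then there is $z\in\mathbb C$ with $|z|=1$ such that $g=zf$ on $I_j$ or $g=z\overline f$ on $I_j$. 2. There is a set $\Gamma\subset(0,1)$ of exactly $L(L+1)/2$ points such that every nonzero $f=\sum_k c_k\phi(\cdot-k)\in\mathcal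 S(\phi)$ satisfying (i) and (ii) below is determined, up to a unimodular constant and conjugation, by $|f|$ on $\Gamma+\mathbb Z$: if $g\in\mathcal S(\phi)$ and $|g(\gamma+j)|=|f(\gamma+j)|$ for all $\gamma\in\Gamma$, $j\in\mathbb Z$, then there is $z\in\mathbb C$ with $|z|=1$ such that $g=zf$ on $\mathbb R$ or $g=z\overline f$ on $\mathbb R$. The conditions are stated in terms of the following elements of $\mathbb Z\cup\{\pm\infty\}$ (with $\inf\emptyset=+\infty$, $\sup\emptyset=-\infty$): $K_-=\inf\{k:c_k\ne0\}$, $K_+=\sup\{k:c_k\ne0\}$; $\kappa_-$ is the supremum of the integers $k$ for which there is $\xi_1\in\mathbb C$, $|\xi_1|=1$, with $\Im(\overline{\xi_1}c_l)=0$ for all $l\le k$; $\kappa_+$ is the infimum of the integers $k>\kappa_-$ for which there is $\xi_2\in\mathbb C$, $|\xi_2|=1$, with $\Im(\overline{\xi_2}c_l)=0$ for all $l\ge k$. (i) $\displaystyle\sum_{l=0}^{L-2}|c_{k+l}|\ne0$ for all integers $k$ with $K_--L+1<k<K_++1$. (ii) If there is an integer strictly between $\kappa_-$ and $\kappa_+$,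 then $\displaystyle\sum_{k-L+2\le n_1<n_2\le k}|\Im(c_{n_1}\overline{c_{n_2}})|\ne0$ for all integers $k$ with $\kappa_-+1\le k\le\kappa_++L-3$. -/

import Mathlib

noncomputable section

/-- The function `x ↦ ∑ₖ cₖ φ(x - k)`.  For compactly supported `φ` the sum is finite at each `x`. -/
def shiftSeries (φ : ℝ → ℝ) (c : ℤ → ℂ) : ℝ → ℂ :=
  fun x => ∑' k : ℤ, c k * ((φ (x - (k : ℝ)) : ℝ) : ℂ)

/-- The complex shift-invariant space generated by `φ`. -/
def shiftInvariantSpace (φ : ℝ → ℝ) : Set (ℝ → ℂ) :=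
  {f | ∃ c : ℤ → ℂ, f = shiftSeries φ c}

/-- The index set `K_A` of the shifts `φ(· - k)` that do not vanish identically on `A`. -/
def activeShifts (φ : ℝ → ℝ) (A : Set ℝ) : Set ℤ :=
  {k | ∃ x ∈ A, φ (x - (k : ℝ)) ≠ 0}

/-- Local linear independence of `φ` on `A`. -/
def LocallyLinearIndependentOn (φ : ℝ → ℝ) (A : Set ℝ) : Prop :=
  ∀ c : ℤ → ℂ, (∀ x ∈ A, shiftSeries φ c x = 0) → ∀ k ∈ activeShifts φ A, c k = 0

/-- `g = z f` on `A`, or `g = z conj f` on `A`, for a single unimodular constant `z`. -/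
def EqUpToPhaseConjOn (A : Set ℝ) (f g : ℝ → ℂ) : Prop :=
  ∃ z : ℂ, ‖z‖ = 1 ∧
    ((∀ x ∈ A, g x = z * f x) ∨ (∀ x ∈ A, g x = z * (starRingEnd ℂ) (f x)))

/-- `f` is locally conjugate phase retrievable on `A` among the elements of the space. -/
def LocallyCPROn (φ : ℝ → ℝ) (A : Set ℝ) (f : ℝ → ℂ) : Prop :=
  ∀ g ∈ shiftInvariantSpace φ, (∀ x ∈ A, ‖f x‖ = ‖g x‖) → EqUpToPhaseConjOn A f g

/-- The whole space is locally conjugate phase retrievable on `A`. -/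
def SpaceLocallyCPROn (φ : ℝ → ℝ) (A : Set ℝ) : Prop :=
  ∀ f ∈ shiftInvariantSpace φ, LocallyCPROn φ A f

/-- On the whole line, `f` is determined up to a unimodular constant and conjugation, among the
elements of the space, by its phaseless samples on `Λ`. -/
def DeterminedBySamplesOn (φ : ℝ → ℝ) (Λ : Set ℝ) (f : ℝ → ℂ) : Prop :=
  ∀ g ∈ shiftInvariantSpace φ, (∀ x ∈ Λ, ‖f x‖ = ‖g x‖) → EqUpToPhaseConjOn Set.univ f g

/-- The set `Γ + ℤ`. -/
def addIntegers (Γ : Set ℝ) : Set ℝ := {x | ∃ γ ∈ Γ, ∃ j : ℤ, x = γ + (j : ℝ)}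

/-- The space of real symmetric `L × L` matrices. -/
def symmetricMatrices (L : ℕ) : Submodule ℝ (Matrix (Fin L) (Fin L) ℝ) where
  carrier := {M | M.IsSymm}
  add_mem' := fun ha hb => Matrix.IsSymm.add ha hb
  zero_mem' := Matrix.isSymm_zero
  smul_mem' := fun r _ hM => Matrix.IsSymm.smul hM r

/-- The vector `Φ(x) = (φ(x), φ(x + 1), …, φ(x + L - 1))`: for `φ` vanishing outside `[0, L]` and
`x ∈ (0, 1)` these are the values at `x` of all shifts that can be nonzero on `(0, 1)`. -/
def shiftVector (φ : ℝ → ℝ) (L : ℕ) (x : ℝ) : Fin L → ℝ := fun i => φ (x + ((i : ℕ) : ℝ))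

/-- The span of the outer products `Φ(x) Φ(x)ᵀ`, `x ∈ (0, 1)`. -/
def outerProductSpan (φ : ℝ → ℝ) (L : ℕ) : Submodule ℝ (Matrix (Fin L) (Fin L) ℝ) :=
  Submodule.span ℝ
    {M | ∃ x ∈ Set.Ioo (0 : ℝ) 1, M = Matrix.vecMulVec (shiftVector φ L x) (shiftVector φ L x)}

/-- Integers as extended real numbers. -/
def intToEReal (k : ℤ) : EReal := ((k : ℝ) : EReal)

/-- `K₋ = inf {k : cₖ ≠ 0}`. -/
def Kminus (c : ℤ → ℂ) : EReal := sInf (intToEReal '' {k : ℤ | c k ≠ 0})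

/-- `K₊ = sup {k : cₖ ≠ 0}`. -/
def Kplus (c : ℤ → ℂ) : EReal := sSup (intToEReal '' {k : ℤ | c k ≠ 0})

/-- `κ₋`: the supremum of the integers `k` such that the coefficients `c_l`, `l ≤ k`, are real up to
a common unimodular constant `ξ₁`. -/
def kappaMinus (c : ℤ → ℂ) : EReal :=
  sSup (intToEReal '' {k : ℤ | ∃ ξ : ℂ, ‖ξ‖ = 1 ∧ ∀ l ≤ k, ((starRingEnd ℂ) ξ * c l).im = 0})

/-- `κ₊`: the infimum of the integers `k > κ₋` such that the coefficients `c_l`, `l ≥ k`, are real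
up to a common unimodular constant `ξ₂`. -/
def kappaPlus (c : ℤ → ℂ) : EReal :=
  sInf (intToEReal '' {k : ℤ | kappaMinus c < intToEReal k ∧
    ∃ ξ : ℂ, ‖ξ‖ = 1 ∧ ∀ l ≥ k, ((starRingEnd ℂ) ξ * c l).im = 0})

/-- The middle index set: all integers strictly between `κ₋` and `κ₊`. -/
def middleSet (c : ℤ → ℂ) : Set ℤ :=
  {k | kappaMinus c < intToEReal k ∧ intToEReal k < kappaPlus c}

/-- Condition (i): no block of `L - 1` consecutive coefficients that meets the range between
`K₋` and `K₊` vanishes. -/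
def NoGapCondition (L : ℕ) (c : ℤ → ℂ) : Prop :=
  ∀ k : ℤ, Kminus c - (L : EReal) + 1 < intToEReal k → intToEReal k < Kplus c + 1 →
    ∑ l ∈ Finset.range (L - 1), ‖c (k + (l : ℤ))‖ ≠ 0

/-- Condition (ii): if the middle index set is non-empty, then
`∑_{k-L+2 ≤ n₁ < n₂ ≤ k} |Im (c_{n₁} conj c_{n₂})| ≠ 0` for all `k` with
`κ₋ + 1 ≤ k ≤ κ₊ + L - 3`. -/
def NonCollinearCondition (L : ℕ) (c : ℤ → ℂ) : Prop :=
  (middleSet c).Nonempty →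
    ∀ k : ℤ, kappaMinus c + 1 ≤ intToEReal k → intToEReal k ≤ kappaPlus c + (L : EReal) - 3 →
      ∑ n₁ ∈ Finset.Icc (k - (L : ℤ) + 2) k, ∑ n₂ ∈ Finset.Ioc n₁ k,
        |(c n₁ * (starRingEnd ℂ) (c n₂)).im| ≠ 0

end

/-!
Write `f = ∑ cₖ φ(· - k)` and `g = ∑ dₖ φ(· - k)`. On `(j, j + 1)` only the `L` coefficients
`c_{j-L+1}, …, c_j` enter, and `|f(x + j)|²` is the pairing of `Φ(x) Φ(x)ᵀ` with the real Gram
matrix `Re (c_m conj c_n)` of these coefficients, regarded as vectors of the plane `ℂ = ℝ²`. As the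
matrices `Φ(x) Φ(x)ᵀ` span all symmetric matrices, already for `L (L + 1) / 2` suitable points `x`
(`exists_finset_span_outerProduct`), phaseless values on `(j, j + 1)` amount to that Gram matrix
(`re_mul_conj_eq_of_norm_eq`). Two families of plane vectors with the same Gram matrix differ by a
linear isometry of the plane (`exists_isometry_of_re_mul_conj_eq`), which is a rotation or a
rotation composed with conjugation. This gives the local statement.

For the global one, every window of `L` consecutive coefficients is matched by some isometry. A
window `[p, q]` with more than `L` elements is matched, by induction on its length, once
`[p, q - 1]` and `[p + 1, q]` are and `c_p` or `c_q` lies in the real span of the interior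
coefficients: then one of the two isometries is already determined by its values on the overlap
(`isometry_glue`). `NoGapCondition` and `NonCollinearCondition` guarantee this
(`mem_span_interior`). Otherwise `c_p` and `c_q` are nonzero, so by the former some `c_i` among the
first `L - 1` interior coefficients is nonzero; these do not span the plane, so they all lie on the
line `ℝ c_i`, which contains neither `c_p` nor `c_q`. Hence `κ₋ < i < κ₊`, and the latter applies to
the first `L - 1` interior coefficients and says that they are not collinear, a contradiction.
-/

open ComplexConjugate

/-! ### Plane vectors with equal Gram matrices -/

/-- Two families of plane vectors with the same real Gram matrix differ by a linear isometry.
After dividing out one nonzero member, the two families have the same real parts and equal products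
of imaginary parts, so the imaginary parts agree up to one common sign. -/
theorem exists_isometry_of_re_mul_conj_eq {ι : Type*} (c d : ι → ℂ)
    (h : ∀ i j, (c i * conj (c j)).re = (d i * conj (d j)).re) :
    ∃ T : ℂ ≃ₗᵢ[ℝ] ℂ, ∀ i, d i = T (c i) := by
  have hn : ∀ i, ‖d i‖ = ‖c i‖ := fun i => by
    have := h i i
    rw [Complex.mul_conj, Complex.mul_conj, Complex.ofReal_re, Complex.ofReal_re,
      Complex.normSq_eq_norm_sq, Complex.normSq_eq_norm_sq] at this
    exact ((sq_eq_sq₀ (norm_nonneg _) (norm_nonneg _)).mp this).symm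
  by_cases h0 : ∀ i, c i = 0
  · refine ⟨LinearIsometryEquiv.refl ℝ ℂ, fun i => ?_⟩
    have : ‖d i‖ = 0 := by rw [hn, h0, norm_zero]
    simp [h0 i, norm_eq_zero.mp this]
  push Not at h0
  obtain ⟨o, ho⟩ := h0
  have hdo : d o ≠ 0 := norm_ne_zero_iff.mp (by rw [hn]; exact norm_ne_zero_iff.mpr ho)
  have hre : ∀ i, (d i * conj (d o)).re = (c i * conj (c o)).re := fun i => (h i o).symm
  have him : ∀ i j, (d i * conj (d o)).im * (d j * conj (d o)).im =
      (c i * conj (c o)).im * (c j * conj (c o)).im := fun i j => by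
    have h1 := h i j
    have h2 := h o o
    have h3 := h i o
    have h4 := h j o
    simp only [Complex.mul_re, Complex.mul_im, Complex.conj_re, Complex.conj_im] at *
    linear_combination (-((d o).re * (d o).re - (d o).im * -(d o).im)) * h1
      - ((c i).re * (c j).re - (c i).im * -(c j).im) * h2
      + ((c j).re * (c o).re - (c j).im * -(c o).im) * h3
      + ((d i).re * (d o).re - (d i).im * -(d o).im) * h4
  have hsq : d o * conj (d o) = c o * conj (c o) := by
    rw [Complex.mul_conj, Complex.mul_conj, Complex.normSq_eq_norm_sq, Complex.normSq_eq_norm_sq,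
      hn]
  have hco' : conj (c o) ≠ 0 := (map_ne_zero _).mpr ho
  have hdo' : conj (d o) ≠ 0 := (map_ne_zero _).mpr hdo
  by_cases hs : ∀ i, (d i * conj (d o)).im = (c i * conj (c o)).im
  · have hz : ‖d o / c o‖ = 1 := by
      rw [norm_div, hn, div_self (norm_ne_zero_iff.mpr ho)]
    obtain ⟨u, hu⟩ : ∃ u : Circle, (u : ℂ) = d o / c o :=
      ⟨⟨_, mem_sphere_zero_iff_norm.mpr hz⟩, rfl⟩
    refine ⟨rotation u, fun i => ?_⟩
    have he : d i * conj (d o) = c i * conj (c o) := Complex.ext (hre i) (hs i)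
    rw [rotation_apply, hu, div_mul_eq_mul_div, eq_div_iff ho]
    apply mul_right_cancel₀ hdo'
    linear_combination c o * he - c i * hsq
  · push Not at hs
    obtain ⟨i, hi⟩ := hs
    have hii : (d i * conj (d o)).im = -(c i * conj (c o)).im :=
      (sq_eq_sq_iff_eq_or_eq_neg.mp (by rw [sq, sq]; exact him i i)).resolve_left hi
    have hi0 : (c i * conj (c o)).im ≠ 0 := fun h0 => hi (by rw [hii, h0, neg_zero])
    have hz : ‖d o / conj (c o)‖ = 1 := by
      rw [norm_div, hn, RCLike.norm_conj, div_self (norm_ne_zero_iff.mpr ho)]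
    obtain ⟨u, hu⟩ : ∃ u : Circle, (u : ℂ) = d o / conj (c o) :=
      ⟨⟨_, mem_sphere_zero_iff_norm.mpr hz⟩, rfl⟩
    refine ⟨Complex.conjLIE.trans (rotation u), fun j => ?_⟩
    have hj : (d j * conj (d o)).im = -(c j * conj (c o)).im := by
      apply mul_left_cancel₀ hi0
      have := him i j
      rw [hii] at this
      linear_combination -this
    have he : d j * conj (d o) = conj (c j) * c o := by
      have : d j * conj (d o) = conj (c j * conj (c o)) :=
        Complex.ext (by rw [hre, Complex.conj_re]) (by rw [hj, Complex.conj_im])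
      rw [this, map_mul, Complex.conj_conj]
    rw [LinearIsometryEquiv.trans_apply, rotation_apply, Complex.conjLIE_apply, hu,
      div_mul_eq_mul_div, eq_div_iff hco']
    apply mul_right_cancel₀ hdo'
    linear_combination conj (c o) * he - conj (c j) * hsq

/-- An isometry preserves the real inner product `Re (a conj b)`. -/
theorem re_mul_conj_isometry (T : ℂ ≃ₗᵢ[ℝ] ℂ) (a b : ℂ) :
    (T a * conj (T b)).re = (a * conj b).re := by
  have := T.inner_map_map b a
  rwa [Complex.inner, Complex.inner] at this

theorem eqUpToPhaseConjOn_of_isometry {A : Set ℝ} {f g : ℝ → ℂ} (T : ℂ ≃ₗᵢ[ℝ] ℂ)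
    (h : ∀ x ∈ A, g x = T (f x)) : EqUpToPhaseConjOn A f g := by
  obtain ⟨a, rfl | rfl⟩ := linear_isometry_complex T
  · exact ⟨a, Circle.norm_coe a, Or.inl fun x hx => by rw [h x hx, rotation_apply]⟩
  · exact ⟨a, Circle.norm_coe a, Or.inr fun x hx => by
      rw [h x hx, LinearIsometryEquiv.trans_apply, rotation_apply, Complex.conjLIE_apply]⟩

/-- If an isometry matches `c` with `d` on `A`, another one does so on `B`, and the values of `c` on
`A ∩ B` span those on `A`, then the second isometry matches `c` with `d` on `A` too. -/
theorem isometry_glue {c d : ℤ → ℂ} {A B : Set ℤ} {T S : ℂ ≃ₗᵢ[ℝ] ℂ}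
    (hT : ∀ l ∈ A, d l = T (c l)) (hS : ∀ l ∈ B, d l = S (c l))
    (hspan : ∀ l ∈ A, c l ∈ Submodule.span ℝ (c '' (A ∩ B))) :
    ∀ l ∈ A, d l = S (c l) := by
  have hTS : Set.EqOn T.toLinearEquiv.toLinearMap S.toLinearEquiv.toLinearMap (c '' (A ∩ B)) := by
    rintro _ ⟨l, ⟨hA, hB⟩, rfl⟩
    exact (hT l hA).symm.trans (hS l hB)
  exact fun l hl => (hT l hl).trans (LinearMap.eqOn_span hTS (hspan l hl))

/-- Two plane vectors with nonzero determinant span the plane. -/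
theorem mem_span_of_im_mul_conj_ne_zero {s : Set ℂ} {a b : ℂ} (ha : a ∈ s) (hb : b ∈ s)
    (h : (a * conj b).im ≠ 0) (w : ℂ) : w ∈ Submodule.span ℝ s := by
  -- Cramer's rule
  have hw : w = ((w * conj b).im / (a * conj b).im) • a
      + (-(w * conj a).im / (a * conj b).im) • b := by
    simp only [Complex.mul_im, Complex.conj_re, Complex.conj_im] at h ⊢
    apply Complex.ext
    · rw [Complex.add_re, Complex.real_smul, Complex.real_smul, Complex.re_ofReal_mul,
        Complex.re_ofReal_mul, div_mul_eq_mul_div, div_mul_eq_mul_div, ← add_div, eq_div_iff h]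
      ring
    · rw [Complex.add_im, Complex.real_smul, Complex.real_smul, Complex.im_ofReal_mul,
        Complex.im_ofReal_mul, div_mul_eq_mul_div, div_mul_eq_mul_div, ← add_div, eq_div_iff h]
      ring
  rw [hw]
  exact add_mem (Submodule.smul_mem _ _ (Submodule.subset_span ha))
    (Submodule.smul_mem _ _ (Submodule.subset_span hb))

/-- Two plane vectors on one real line have zero determinant. -/
theorem im_mul_conj_eq_zero_of_line {ξ a b : ℂ} (hξ : ‖ξ‖ = 1) (ha : (conj ξ * a).im = 0)
    (hb : (conj ξ * b).im = 0) : (a * conj b).im = 0 := by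
  have h1 : ξ * conj ξ = 1 := by
    rw [Complex.mul_conj, Complex.normSq_eq_norm_sq, hξ]; simp
  have : a * conj b = (conj ξ * a) * conj (conj ξ * b) := by
    rw [map_mul, Complex.conj_conj]
    linear_combination (-(a * conj b)) * h1
  rw [this, Complex.mul_im, Complex.conj_re, Complex.conj_im, ha, hb]
  ring

/-! ### Window values and the Gram matrix -/

/-- On `(j, j + 1)` the series reduces to the `L` terms with index `j - i`, `0 ≤ i < L`. -/
theorem shiftSeries_eq_sum {φ : ℝ → ℝ} {L : ℕ}
    (hsupp : ∀ t : ℝ, t ∉ Set.Icc (0 : ℝ) (L : ℝ) → φ t = 0) (c : ℤ → ℂ) (j : ℤ) {x : ℝ}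
    (hx : x ∈ Set.Ioo (0 : ℝ) 1) :
    shiftSeries φ c (x + j) = ∑ i : Fin L, c (j - (i : ℕ)) * (shiftVector φ L x i : ℂ) := by
  have hinj : Function.Injective fun i : Fin L => j - ((i : ℕ) : ℤ) := fun a b hab => by
    simp only at hab
    exact Fin.ext (by omega)
  unfold shiftSeries
  rw [tsum_eq_sum (s := Finset.univ.map ⟨_, hinj⟩), Finset.sum_map]
  · refine Finset.sum_congr rfl fun i _ => ?_
    simp only [Function.Embedding.coeFn_mk, shiftVector]
    congr 3
    push_cast
    ring
  · intro k hk
    rw [hsupp, Complex.ofReal_zero, mul_zero]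
    rintro ⟨h0, h1⟩
    apply hk
    have h2 : k < j + 1 := by
      have : (k : ℝ) < j + 1 := by linarith [hx.2]
      exact_mod_cast this
    have h3 : j < k + L := by
      have : (j : ℝ) < k + L := by linarith [hx.1]
      exact_mod_cast this
    refine Finset.mem_map.mpr ⟨⟨(j - k).toNat, by omega⟩, Finset.mem_univ _, ?_⟩
    simp only [Function.Embedding.coeFn_mk]
    omega

theorem norm_sq_sum_mul_ofReal {ι : Type*} [Fintype ι] (a : ι → ℂ) (v : ι → ℝ) :
    ‖∑ i, a i * (v i : ℂ)‖ ^ 2 =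
      ∑ i, ∑ j, (a i * conj (a j)).re * Matrix.vecMulVec v v i j := by
  rw [← Complex.normSq_eq_norm_sq, ← Complex.ofReal_re (Complex.normSq _), ← Complex.mul_conj,
    map_sum, Finset.sum_mul_sum, Complex.re_sum]
  refine Finset.sum_congr rfl fun i _ => ?_
  rw [Complex.re_sum]
  refine Finset.sum_congr rfl fun j _ => ?_
  rw [map_mul, Complex.conj_ofReal, Matrix.vecMulVec_apply, mul_mul_mul_comm, ← Complex.ofReal_mul,
    Complex.re_mul_ofReal]

/-- Equal phaseless values against vectors whose outer products span the symmetric matrices force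
equal Gram matrices. -/
theorem re_mul_conj_eq_of_norm_eq {L : ℕ} {ι : Type*} (v : ι → Fin L → ℝ)
    (hv : symmetricMatrices L ≤
      Submodule.span ℝ (Set.range fun t => Matrix.vecMulVec (v t) (v t)))
    {a b : Fin L → ℂ} (h : ∀ t, ‖∑ i, a i * (v t i : ℂ)‖ = ‖∑ i, b i * (v t i : ℂ)‖)
    (i j : Fin L) : (a i * conj (a j)).re = (b i * conj (b j)).re := by
  -- the pairing with the difference of the two Gram matrices vanishes on symmetric matrices
  have key : ∀ M ∈ symmetricMatrices L,
      ∑ i, ∑ j, ((a i * conj (a j)).re - (b i * conj (b j)).re) * M i j = 0 := by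
    intro M hM
    replace hM := hv hM
    induction hM using Submodule.span_induction with
    | mem M hM =>
      obtain ⟨t, rfl⟩ := hM
      have := norm_sq_sum_mul_ofReal a (v t)
      rw [h t, norm_sq_sum_mul_ofReal] at this
      simp only [sub_mul, Finset.sum_sub_distrib]
      rw [this, sub_self]
    | zero => simp
    | add M N _ _ hM hN =>
      simp only [Matrix.add_apply, mul_add, Finset.sum_add_distrib, hM, hN, add_zero]
    | smul r M _ hM =>
      simp only [Matrix.smul_apply, smul_eq_mul, mul_left_comm _ r, ← Finset.mul_sum, hM, mul_zero]
  have hsym : Matrix.single i j (1 : ℝ) + Matrix.single j i 1 ∈ symmetricMatrices L := by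
    change Matrix.IsSymm _
    rw [Matrix.IsSymm, Matrix.transpose_add, Matrix.transpose_single, Matrix.transpose_single,
      add_comm]
  have hcomm : ∀ z w : ℂ, (z * conj w).re = (w * conj z).re := fun z w => by
    simp only [Complex.mul_re, Complex.conj_re, Complex.conj_im]; ring
  have := key _ hsym
  simp only [Matrix.add_apply, Matrix.single_apply, mul_add, Finset.sum_add_distrib, ite_and,
    mul_ite, mul_one, mul_zero, Finset.sum_ite_eq, Finset.sum_ite_irrel, Finset.sum_const_zero,
    Finset.mem_univ, if_true] at this
  rw [hcomm (a j), hcomm (b j)] at this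
  linarith

/-- A symmetric matrix is a function on unordered pairs of indices. -/
theorem finrank_symmetricMatrices (L : ℕ) :
    Module.finrank ℝ (symmetricMatrices L) = L * (L + 1) / 2 := by
  let e : symmetricMatrices L ≃ₗ[ℝ] (Sym2 (Fin L) → ℝ) :=
    { toFun := fun M => Sym2.lift ⟨fun i j => M.1 i j, fun i j => (M.2.apply j i)⟩
      invFun := fun f => ⟨fun i j => f s(i, j), by
        change Matrix.IsSymm _
        ext i j
        exact congrArg f Sym2.eq_swap⟩
      map_add' := fun M N => by
        ext p
        induction p using Sym2.ind
        rfl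
      map_smul' := fun r M => by
        ext p
        induction p using Sym2.ind
        rfl
      left_inv := fun M => rfl
      right_inv := fun f => by
        ext p
        induction p using Sym2.ind
        rfl }
  rw [e.finrank_eq, Module.finrank_fintype_fun_eq_card, Sym2.card, Fintype.card_fin,
    Nat.choose_two_right, Nat.add_sub_cancel, mul_comm]

/-- Among the outer products there is a basis of the symmetric matrices, so that as many points as
their dimension suffice. -/
theorem exists_finset_span_outerProduct {φ : ℝ → ℝ} {L : ℕ}
    (hspan : outerProductSpan φ L = symmetricMatrices L) :
    ∃ Γ : Finset ℝ, (Γ : Set ℝ) ⊆ Set.Ioo (0 : ℝ) 1 ∧ Γ.card = L * (L + 1) / 2 ∧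
      symmetricMatrices L ≤ Submodule.span ℝ (Set.range fun t : Γ =>
        Matrix.vecMulVec (shiftVector φ L t) (shiftVector φ L t)) := by
  let v : Set.Ioo (0 : ℝ) 1 → Matrix (Fin L) (Fin L) ℝ := fun x =>
    Matrix.vecMulVec (shiftVector φ L x) (shiftVector φ L x)
  have hrange : {M | ∃ x ∈ Set.Ioo (0 : ℝ) 1,
      M = Matrix.vecMulVec (shiftVector φ L x) (shiftVector φ L x)} = Set.range v := by
    ext M
    constructor
    · rintro ⟨x, hx, rfl⟩
      exact ⟨⟨x, hx⟩, rfl⟩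
    · rintro ⟨x, rfl⟩
      exact ⟨x, x.2, rfl⟩
  rw [outerProductSpan, hrange] at hspan
  obtain ⟨κ, a, ha, hs, hli⟩ := exists_linearIndependent' ℝ v
  have : Finite κ := hli.finite
  have := Fintype.ofFinite κ
  refine ⟨Finset.univ.map ⟨fun k => (a k : ℝ), Subtype.val_injective.comp ha⟩, ?_, ?_, ?_⟩
  · intro x hx
    obtain ⟨k, -, rfl⟩ := Finset.mem_map.mp hx
    exact (a k).2
  · rw [Finset.card_map, Finset.card_univ, ← finrank_span_eq_card hli, hs, hspan,
      finrank_symmetricMatrices]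
  · rw [← hspan, ← hs]
    refine Submodule.span_mono ?_
    rintro _ ⟨k, rfl⟩
    exact ⟨⟨a k, Finset.mem_map.mpr ⟨k, Finset.mem_univ _, rfl⟩⟩, rfl⟩

/-! ### The local statement -/

theorem spaceLocallyCPROn_Ioo {φ : ℝ → ℝ} {L : ℕ}
    (hsupp : ∀ t : ℝ, t ∉ Set.Icc (0 : ℝ) (L : ℝ) → φ t = 0)
    (hspan : outerProductSpan φ L = symmetricMatrices L) (j : ℤ) :
    SpaceLocallyCPROn φ (Set.Ioo (j : ℝ) ((j : ℝ) + 1)) := by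
  obtain ⟨Γ, hΓ, -, hv⟩ := exists_finset_span_outerProduct hspan
  rintro _ ⟨c, rfl⟩ _ ⟨d, rfl⟩ hfg
  have hgram := re_mul_conj_eq_of_norm_eq (fun t : Γ => shiftVector φ L t) hv
    (a := fun i => c (j - (i : ℕ))) (b := fun i => d (j - (i : ℕ))) fun t => by
      have ht := hΓ t.2
      rw [← shiftSeries_eq_sum hsupp c j ht, ← shiftSeries_eq_sum hsupp d j ht]
      exact hfg _ ⟨by linarith [ht.1], by linarith [ht.2]⟩
  obtain ⟨T, hT⟩ := exists_isometry_of_re_mul_conj_eq _ _ hgram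
  refine eqUpToPhaseConjOn_of_isometry T fun x hx => ?_
  have hx' : x - j ∈ Set.Ioo (0 : ℝ) 1 := ⟨by linarith [hx.1], by linarith [hx.2]⟩
  have hc := shiftSeries_eq_sum hsupp c j hx'
  have hd := shiftSeries_eq_sum hsupp d j hx'
  rw [sub_add_cancel] at hc hd
  rw [hc, hd, map_sum]
  refine Finset.sum_congr rfl fun i _ => ?_
  rw [mul_comm, mul_comm (c _), ← Complex.real_smul, ← Complex.real_smul, map_smul]
  exact congrArg _ (hT i)

/-! ### Gluing the windows -/

theorem intToEReal_le {a b : ℤ} : intToEReal a ≤ intToEReal b ↔ a ≤ b := by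
  unfold intToEReal
  exact_mod_cast Iff.rfl

theorem intToEReal_lt {a b : ℤ} : intToEReal a < intToEReal b ↔ a < b := by
  unfold intToEReal
  exact_mod_cast Iff.rfl

/-- Noncollinear coefficients up to index `i` bound `κ₋`. -/
theorem kappaMinus_le {c : ℤ → ℂ} {p i : ℤ} (hpi : p ≤ i) (h : (c p * conj (c i)).im ≠ 0) :
    kappaMinus c ≤ intToEReal (i - 1) := by
  refine sSup_le ?_
  rintro _ ⟨k, ⟨ξ, hξ, hl⟩, rfl⟩
  rw [intToEReal_le]
  by_contra! hk
  exact h (im_mul_conj_eq_zero_of_line hξ (hl p (by omega)) (hl i (by omega)))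

/-- Noncollinear coefficients from index `i` on bound `κ₊`. -/
theorem le_kappaPlus {c : ℤ → ℂ} {i q : ℤ} (hiq : i ≤ q) (h : (c q * conj (c i)).im ≠ 0) :
    intToEReal (i + 1) ≤ kappaPlus c := by
  refine le_sInf ?_
  rintro _ ⟨k, ⟨-, ξ, hξ, hl⟩, rfl⟩
  rw [intToEReal_le]
  by_contra! hk
  exact h (im_mul_conj_eq_zero_of_line hξ (hl q (by omega)) (hl i (by omega)))

/-- In a window with more than `L` coefficients, one of the two end coefficients lies in the real
span of the interior ones. -/
theorem mem_span_interior {L : ℕ} {c : ℤ → ℂ} (h₁ : NoGapCondition L c)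
    (h₂ : NonCollinearCondition L c) {p q : ℤ} (hpq : p + L ≤ q) (hL : 2 ≤ L) :
    c p ∈ Submodule.span ℝ (c '' Set.Ioo p q) ∨ c q ∈ Submodule.span ℝ (c '' Set.Ioo p q) := by
  by_contra! hcon
  obtain ⟨hp, hq⟩ := hcon
  have hp0 : c p ≠ 0 := fun h => hp (h ▸ zero_mem _)
  have hq0 : c q ≠ 0 := fun h => hq (h ▸ zero_mem _)
  have hne : ∑ l ∈ Finset.range (L - 1), ‖c (p + 1 + (l : ℤ))‖ ≠ 0 := by
    refine h₁ (p + 1) ?_ ?_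
    · have hK : Kminus c ≤ intToEReal p := sInf_le ⟨p, hp0, rfl⟩
      calc Kminus c - (L : EReal) + 1 ≤ intToEReal p - (L : EReal) + 1 :=
          add_le_add_left (EReal.sub_le_sub hK le_rfl) 1
        _ = intToEReal (p - L + 1) := by unfold intToEReal; push_cast; rfl
        _ < intToEReal (p + 1) := intToEReal_lt.mpr (by omega)
    · have hK : intToEReal q ≤ Kplus c := le_sSup ⟨q, hq0, rfl⟩
      calc intToEReal (p + 1) < intToEReal (q + 1) := intToEReal_lt.mpr (by omega)
        _ = intToEReal q + 1 := by unfold intToEReal; push_cast; rfl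
        _ ≤ Kplus c + 1 := by gcongr
  obtain ⟨l, hl, hcl⟩ := Finset.exists_ne_zero_of_sum_ne_zero hne
  rw [Finset.mem_range] at hl
  obtain ⟨i, hi⟩ : ∃ i, i = p + 1 + (l : ℤ) := ⟨_, rfl⟩
  rw [← hi] at hcl
  have hci : c i ≠ 0 := norm_ne_zero_iff.mp hcl
  have hmem : ∀ k, p < k → k < q → c k ∈ c '' Set.Ioo p q := fun k h h' => ⟨k, ⟨h, h'⟩, rfl⟩
  -- a vector collinear with `c i` is a real multiple of it
  have hline : ∀ w, w ∉ Submodule.span ℝ (c '' Set.Ioo p q) → (w * conj (c i)).im ≠ 0 := by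
    intro w hw h0
    apply hw
    have : w = ((w * conj (c i)).re / Complex.normSq (c i)) • c i := by
      have hr : w * conj (c i) = ((w * conj (c i)).re : ℂ) :=
        Complex.ext (Complex.ofReal_re _).symm (by rw [h0, Complex.ofReal_im])
      rw [Complex.real_smul, Complex.ofReal_div, ← hr, ← Complex.mul_conj]
      have : conj (c i) ≠ 0 := (map_ne_zero _).mpr hci
      field_simp
    rw [this]
    exact Submodule.smul_mem _ _ (Submodule.subset_span (hmem i (by omega) (by omega)))
  have hκm := kappaMinus_le (c := c) (p := p) (i := i) (by omega) (hline _ hp)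
  have hκp := le_kappaPlus (c := c) (q := q) (i := i) (by omega) (hline _ hq)
  have hmid : (middleSet c).Nonempty :=
    ⟨i, hκm.trans_lt (intToEReal_lt.mpr (by omega)),
      (intToEReal_lt.mpr (by omega)).trans_le hκp⟩
  -- the first `L - 1` interior coefficients end at index `p + L - 1`
  refine h₂ hmid (p + L - 1) ?_ ?_ ?_
  · calc kappaMinus c + 1 ≤ intToEReal (i - 1) + 1 := by gcongr
      _ = intToEReal (i - 1 + 1) := by unfold intToEReal; push_cast; rfl
      _ ≤ intToEReal (p + L - 1) := intToEReal_le.mpr (by omega)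
  · calc intToEReal (p + L - 1) ≤ intToEReal (i + 1 + L - 3) := intToEReal_le.mpr (by omega)
      _ = intToEReal (i + 1) + (L : EReal) - 3 := by unfold intToEReal; push_cast; rfl
      _ ≤ kappaPlus c + (L : EReal) - 3 :=
        EReal.sub_le_sub (add_le_add_left hκp _) le_rfl
  · refine Finset.sum_eq_zero fun m hm => Finset.sum_eq_zero fun n hn => ?_
    rw [Finset.mem_Icc] at hm
    rw [Finset.mem_Ioc] at hn
    by_contra hmn
    exact hp (mem_span_of_im_mul_conj_ne_zero (hmem m (by omega) (by omega))
      (hmem n (by omega) (by omega)) (fun h => hmn (abs_eq_zero.mpr h)) _)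

/-- If all windows of `L` coefficients are matched, then so is every window. -/
theorem exists_isometry_Icc {L : ℕ} {c d : ℤ → ℂ} (hL : 2 ≤ L) (h₁ : NoGapCondition L c)
    (h₂ : NonCollinearCondition L c)
    (hw : ∀ p q : ℤ, q < p + L → ∃ T : ℂ ≃ₗᵢ[ℝ] ℂ, ∀ l ∈ Set.Icc p q, d l = T (c l))
    (n : ℕ) (p : ℤ) : ∃ T : ℂ ≃ₗᵢ[ℝ] ℂ, ∀ l ∈ Set.Icc p (p + n), d l = T (c l) := by
  induction n generalizing p with
  | zero => exact hw _ _ (by push_cast; omega)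
  | succ n ih =>
    push_cast
    by_cases hn : p + (n + 1 : ℤ) < p + L
    · exact hw _ _ hn
    obtain ⟨T, hT⟩ := ih p
    obtain ⟨S, hS⟩ := ih (p + 1)
    have hAB : Set.Icc p (p + n) ∩ Set.Icc (p + 1) (p + 1 + n) = Set.Ioo p (p + (n + 1)) := by
      ext l
      simp only [Set.mem_inter_iff, Set.mem_Icc, Set.mem_Ioo]
      omega
    rcases mem_span_interior h₁ h₂ (p := p) (q := p + (n + 1)) (by omega) hL with h | h
    · have hS' := isometry_glue hT hS fun l hl => by
        rw [hAB]
        rcases eq_or_ne l p with rfl | hlp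
        · exact h
        · rw [Set.mem_Icc] at hl
          exact Submodule.subset_span ⟨l, ⟨by omega, by omega⟩, rfl⟩
      refine ⟨S, fun l hl => ?_⟩
      rw [Set.mem_Icc] at hl
      by_cases hlp : l ≤ p + n
      · exact hS' l ⟨hl.1, hlp⟩
      · exact hS l ⟨by omega, by omega⟩
    · have hT' := isometry_glue hS hT fun l hl => by
        rw [Set.inter_comm, hAB]
        rcases eq_or_ne l (p + (n + 1)) with rfl | hlp
        · exact h
        · rw [Set.mem_Icc] at hl
          exact Submodule.subset_span ⟨l, ⟨by omega, by omega⟩, rfl⟩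
      refine ⟨T, fun l hl => ?_⟩
      rw [Set.mem_Icc] at hl
      by_cases hlp : p + 1 ≤ l
      · exact hT' l ⟨hlp, by omega⟩
      · exact hT l ⟨hl.1, by omega⟩

theorem shiftSeries_isometry (φ : ℝ → ℝ) {c d : ℤ → ℂ} (T : ℂ ≃ₗᵢ[ℝ] ℂ)
    (h : ∀ k, d k = T (c k)) (x : ℝ) : shiftSeries φ d x = T (shiftSeries φ c x) := by
  unfold shiftSeries
  rw [← LinearIsometryEquiv.coe_toContinuousLinearEquiv, ContinuousLinearEquiv.map_tsum]
  refine tsum_congr fun k => ?_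
  rw [mul_comm, mul_comm (c k), ← Complex.real_smul, ← Complex.real_smul, map_smul, h]
  rfl

theorem mainTheorem3 (φ : ℝ → ℝ) (L : ℕ) (hL : 3 ≤ L) (hcont : Continuous φ)
    (hsupp : ∀ t : ℝ, t ∉ Set.Icc (0 : ℝ) (L : ℝ) → φ t = 0)
    (hind : ∀ j : ℤ, LocallyLinearIndependentOn φ (Set.Ioo (j : ℝ) ((j : ℝ) + 1)))
    (hspan : outerProductSpan φ L = symmetricMatrices L) :
    (∀ j : ℤ, SpaceLocallyCPROn φ (Set.Ioo (j : ℝ) ((j : ℝ) + 1))) ∧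
    ∃ Γ : Finset ℝ, (Γ : Set ℝ) ⊆ Set.Ioo (0 : ℝ) 1 ∧ Γ.card = L * (L + 1) / 2 ∧
      ∀ c : ℤ → ℂ, shiftSeries φ c ≠ 0 → NoGapCondition L c → NonCollinearCondition L c →
        DeterminedBySamplesOn φ (addIntegers (Γ : Set ℝ)) (shiftSeries φ c) := by
  refine ⟨spaceLocallyCPROn_Ioo hsupp hspan, ?_⟩
  obtain ⟨Γ, hΓ, hcard, hv⟩ := exists_finset_span_outerProduct hspan
  refine ⟨Γ, hΓ, hcard, ?_⟩
  rintro c - h₁ h₂ _ ⟨d, rfl⟩ hfg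
  have hgram : ∀ j : ℤ, ∀ i i' : Fin L,
      (c (j - (i : ℕ)) * conj (c (j - (i' : ℕ)))).re =
        (d (j - (i : ℕ)) * conj (d (j - (i' : ℕ)))).re := fun j =>
    re_mul_conj_eq_of_norm_eq (fun t : Γ => shiftVector φ L t) hv
      (a := fun i => c (j - (i : ℕ))) (b := fun i => d (j - (i : ℕ))) fun t => by
        rw [← shiftSeries_eq_sum hsupp c j (hΓ t.2), ← shiftSeries_eq_sum hsupp d j (hΓ t.2)]
        exact hfg _ ⟨t, t.2, j, rfl⟩
  have hw : ∀ p q : ℤ, q < p + L → ∃ T : ℂ ≃ₗᵢ[ℝ] ℂ, ∀ l ∈ Set.Icc p q, d l = T (c l) := by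
    intro p q hpq
    obtain ⟨T, hT⟩ := exists_isometry_of_re_mul_conj_eq _ _ (hgram q)
    refine ⟨T, fun l hl => ?_⟩
    rw [Set.mem_Icc] at hl
    have := hT ⟨(q - l).toNat, by omega⟩
    simp only at this
    rwa [show q - ((q - l).toNat : ℤ) = l by omega] at this
  -- all pairs of indices lie in a common window, so the Gram matrices over all of `ℤ` agree
  obtain ⟨T, hT⟩ := exists_isometry_of_re_mul_conj_eq c d fun m n => by
    obtain ⟨T, hT⟩ := exists_isometry_Icc (by omega) h₁ h₂ hw (max m n - min m n).toNat (min m n)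
    rw [hT m ⟨by omega, by omega⟩, hT n ⟨by omega, by omega⟩, re_mul_conj_isometry]
  exact eqUpToPhaseConjOn_of_isometry T fun x _ => shiftSeries_isometry φ T hT x
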